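/- Let $V$ be a real vector space, let $R:V\to\mathbb{R}\cup\{+\infty\}$ and $f:\mathbb{R}^m\to\mathbb{R}\cup\{+\infty\}$ be convex functions, and let $\Phi:V\to\mathbb{R}^m$ be linear and surjective. Let $\mathcal{S}$ be the set of minimizers of $R+f\circ\Phi$ over $V$, let $p\in\mathcal{S}$ satisfy $t:=R(p)+f(\Phi p)<+\infty$, and assume that the level set $\{R\le R(p)\}=\{u\in V: R(u)\le R(p)\}$ is linearly closed (its intersection with every line is closed in that line) and contains no line. A *face* of a convex set $C$ is a convex subset $F\subseteq C$ such that every open segment contained in $C$ that meets $F$ is contained in $F$ (the endpoints of the segment need not belong to $C$ or to $F$). The dimension of a set is the dimension of its affine hull $\mathrm{Aff}$. For $x\in C$, the minimal face $\mathcal{F}_x(C)$ is the intersection of all faces of $C$ that contain $x$. Let $\ell$ be the dimension of $\mathcal{F}_{\Phi p}(\{f\le f(\Phi p)\})$, where $\{f\le f(\Phi p)\}=\{w\in\mathbb{R}^m: f(w)\le f(\Phi p)\}$. If $p$ belongs to a face of $\mathcal{S}$ of finite dimension $j$, then $p$ belongs to a face of $\{R\le R(p)\}$ of dimension at most $k$,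 where $$k=\begin{cases} m-\ell+j-1 & \text{if } R(p)>\inf R \text{ or } f(\Phi p)>\inf f,\\ m-\ell+j & \text{otherwise.}\end{cases}$$ Moreover, let $\operatorname{epi}(R)=\{(u,r)\in V\times\mathbb{R}: R(u)\le r\}$ and $\operatorname{hypo}(t-f)=\{(w,r)\in\mathbb{R}^m\times\mathbb{R}: r\le t-f(w)\}$. If the double obliqueness condition holds, that is, if $\mathrm{Aff}\big(\mathcal{F}_p(\{R\le R(p)\})\big)\times\{R(p)\}$ has codimension $1$ in $\mathrm{Aff}\big(\mathcal{F}_{(p,R(p))}(\operatorname{epi}(R))\big)$ and $\mathrm{Aff}\big(\mathcal{F}_{\Phi p}(\{f\le f(\Phi p)\})\big)\times\{t-f(\Phi p)\}$ has codimension $1$ in $\mathrm{Aff}\big(\mathcal{F}_{(\Phi p,\,t-f(\Phi p))}(\operatorname{hypo}(t-f))\big)$, then $p$ belongs to a face of $\{R\le R(p)\}$ of dimension at most $m-\ell+j-2$. -/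

import Mathlib

namespace FacePrinciple

/-- `{x | g x ≤ c}`. -/
def levelSet {E : Type*} (g : E → EReal) (c : EReal) : Set E := {x | g x ≤ c}

/-- `{(x, r) ∈ E × ℝ | g x ≤ r}`. -/
def epigraph {E : Type*} (g : E → EReal) : Set (E × ℝ) := {q | g q.1 ≤ (q.2 : EReal)}

/-- `{(x, r) ∈ E × ℝ | r ≤ g x}`. -/
def hypograph {E : Type*} (g : E → EReal) : Set (E × ℝ) := {q | (q.2 : EReal) ≤ g q.1}

section Faces

variable {E : Type*} [AddCommGroup E] [Module ℝ E]

/-- A convex function `E → ℝ ∪ {+∞}`: the value `-∞` is excluded and the epigraph is convex. -/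
def IsConvexFun (g : E → EReal) : Prop :=
  (∀ x, g x ≠ ⊥) ∧ Convex ℝ (epigraph g)

/-- The intersection of `C` with every line `a + ℝ v` is closed in that line. -/
def LinearlyClosed (C : Set E) : Prop :=
  ∀ a v : E, v ≠ 0 → IsClosed {t : ℝ | a + t • v ∈ C}

/-- `C` contains a line `a + ℝ v`, `v ≠ 0`. -/
def ContainsLine (C : Set E) : Prop :=
  ∃ a v : E, v ≠ 0 ∧ ∀ t : ℝ, a + t • v ∈ C

/-- `F` is a face of `C`: a convex subset of `C` that contains every open interval of `C` which it
meets. The endpoints of the interval are not required to lie in `C` or in `F`, so that this is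
weaker than being a convex `IsExtreme` subset: `(0, 1)` is a face of `[0, 1]`. (For `x = y` the
condition is trivially true.) -/
def IsFace (C F : Set E) : Prop :=
  F ⊆ C ∧ Convex ℝ F ∧
    ∀ x y : E, openSegment ℝ x y ⊆ C → (openSegment ℝ x y ∩ F).Nonempty → openSegment ℝ x y ⊆ F

/-- The minimal (elementary) face of `x` in `C`: the intersection of all faces containing `x`. -/
def minFace (C : Set E) (x : E) : Set E := ⋂₀ {F | IsFace C F ∧ x ∈ F}

/-- The dimension of a set: the dimension of its affine hull (possibly infinite). -/
noncomputable def affDim (F : Set E) : Cardinal := Module.rank ℝ (affineSpan ℝ F).direction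

/-- The codimension of the affine subspace `S` in an affine subspace `T` that contains it. -/
noncomputable def affCodim (S T : AffineSubspace ℝ E) : Cardinal :=
  Module.rank ℝ (T.direction ⧸ S.direction.submoduleOf T.direction)

end Faces

variable {V : Type*} [AddCommGroup V] [Module ℝ V] {m : ℕ}

/-- The set of minimizers of `R + f ∘ Φ`. -/
def solutionSet (R : V → EReal) (f : (Fin m → ℝ) → EReal) (Φ : V →ₗ[ℝ] (Fin m → ℝ)) : Set V :=
  {u | ∀ v, R u + f (Φ u) ≤ R v + f (Φ v)}

/-- The minimal face of `(p, R p)` in the epigraph of `R` is oblique: the affine hull of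
`(minimal face of p in {R ≤ R p}) × {R p}` has codimension one in its affine hull. -/
def EpiOblique (R : V → EReal) (p : V) : Prop :=
  affCodim
    (affineSpan ℝ (minFace (levelSet R (R p)) p ×ˢ ({(R p).toReal} : Set ℝ)))
    (affineSpan ℝ (minFace (epigraph R) (p, (R p).toReal))) = 1

/-- The minimal face of `(w, t - f w)` in the hypograph of `t - f` is oblique: the affine hull of
`(minimal face of w in {f ≤ f w}) × {t - f w}` has codimension one in its affine hull. -/
def HypoOblique (t : EReal) (f : (Fin m → ℝ) → EReal) (w : Fin m → ℝ) : Prop :=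
  affCodim
    (affineSpan ℝ (minFace (levelSet f (f w)) w ×ˢ ({(t - f w).toReal} : Set ℝ)))
    (affineSpan ℝ (minFace (hypograph fun z => t - f z) (w, (t - f w).toReal))) = 1

/-- The double obliqueness condition at `p`; at a minimizer `p`, the number `R p + f (Φ p)` is the
minimal value of the problem. -/
def DoublyOblique (R : V → EReal) (f : (Fin m → ℝ) → EReal) (Φ : V →ₗ[ℝ] (Fin m → ℝ))
    (p : V) : Prop :=
  EpiOblique R p ∧ HypoOblique (R p + f (Φ p)) f (Φ p)

/-- `p` lies in a face of `C` whose dimension is finite and at most `k`. -/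
def InFaceOfDimLE (C : Set V) (p : V) (k : ℤ) : Prop :=
  ∃ F : Set V, IsFace C F ∧ p ∈ F ∧ ∃ d : ℕ, affDim F = d ∧ (d : ℤ) ≤ k

end FacePrinciple

open FacePrinciple

/-! At a point `x` of a convex set, the two-sided feasible directions form a subspace
(`faceDirections`) that is the direction of the minimal face and lies in the direction of every face
through `x`. The theorem thus becomes a dimension count. Let `W` and `B` be these subspaces for the
level sets of `R` at `p` and of `f` at `Φ p`. Along a direction of `W ∩ Φ⁻¹B` neither term exceeds
its value at `p`, so one stays among the minimizers. Hence this intersection has dimension at most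
`j`, and `dim W + ℓ ≤ j + dim (Φ W + B)` (`finrank_levelSet_le`). If one term is not minimal, `Φ W +
B` is proper, since otherwise a descent direction of that term could be corrected to leave the other
at its level (`map_sup_ne_top`).

Under double obliqueness the same count is made for the epigraph and the hypograph, with `Φ × id`
(`finrank_epigraph_add_le`). The sum is proper in dimension `m + 1`, and each of the two subspaces
gains at least one dimension over its level set, whence `- 2`. -/

namespace FacePrinciple

/-! ### Feasible directions and minimal faces -/

section Directions

variable {E : Type*} [AddCommGroup E] [Module ℝ E]

/-- `v` is a feasible direction of `C` at `x`. -/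
def Feasible (C : Set E) (x v : E) : Prop :=
  ∃ ε > (0 : ℝ), ∀ s : ℝ, 0 ≤ s → s ≤ ε → x + s • v ∈ C

theorem feasible_zero {C : Set E} {x : E} (hx : x ∈ C) : Feasible C x 0 :=
  ⟨1, one_pos, fun s _ _ => by simpa using hx⟩

theorem Feasible.add {C : Set E} (hC : Convex ℝ C) {x v w : E} (hv : Feasible C x v)
    (hw : Feasible C x w) : Feasible C x (v + w) := by
  obtain ⟨ε, hε, h⟩ := hv
  obtain ⟨δ, hδ, k⟩ := hw
  -- `x + s • (v + w)` is the midpoint of `x + 2s • v` and `x + 2s • w`.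
  refine ⟨min ε δ / 2, by positivity, fun s hs hs' => ?_⟩
  have h1 := h (2 * s) (by linarith) (by linarith [min_le_left ε δ])
  have h2 := k (2 * s) (by linarith) (by linarith [min_le_right ε δ])
  have h3 := hC h1 h2 (a := 1 / 2) (b := 1 / 2) (by norm_num) (by norm_num) (by norm_num)
  convert h3 using 1
  module

theorem Feasible.smul {C : Set E} {x v : E} (hv : Feasible C x v) {c : ℝ} (hc : 0 ≤ c) :
    Feasible C x (c • v) := by
  obtain ⟨ε, hε, h⟩ := hv
  refine ⟨ε / (c + 1), by positivity, fun s hs hs' => ?_⟩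
  rw [smul_smul]
  refine h _ (by positivity) ?_
  rw [le_div_iff₀ (by positivity)] at hs'
  nlinarith

theorem feasible_sub {C : Set E} (hC : Convex ℝ C) {x y : E} (hx : x ∈ C) (hy : y ∈ C) :
    Feasible C x (y - x) := by
  refine ⟨1, one_pos, fun s hs hs' => ?_⟩
  convert hC hx hy (a := 1 - s) (b := s) (by linarith) hs (by ring) using 1
  module

/-- The subspace of the directions along which `C` extends on both sides of `x`. -/
def faceDirections {C : Set E} (hC : Convex ℝ C) {x : E} (hx : x ∈ C) : Submodule ℝ E where
  carrier := {v | Feasible C x v ∧ Feasible C x (-v)}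
  zero_mem' := by simpa using feasible_zero hx
  add_mem' := by
    rintro v w ⟨h1, h2⟩ ⟨h3, h4⟩
    refine ⟨h1.add hC h3, ?_⟩
    rw [neg_add]
    exact h2.add hC h4
  smul_mem' := by
    rintro c v ⟨h1, h2⟩
    rcases le_total 0 c with hc | hc
    · exact ⟨h1.smul hc, by simpa using h2.smul hc⟩
    · have hc' : 0 ≤ -c := by linarith
      exact ⟨by simpa using h2.smul hc', by simpa using h1.smul hc'⟩

/-- A face through `x` contains a segment in every two-sided direction of the ambient set. -/
theorem IsFace.mem_vectorSpan {C F : Set E} (hF : IsFace C F) {x v : E} (hx : x ∈ F)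
    (h₁ : Feasible C x v) (h₂ : Feasible C x (-v)) :
    ∃ ε > (0 : ℝ), x + ε • v ∈ F := by
  obtain ⟨ε, hε, h⟩ := h₁
  obtain ⟨δ, hδ, k⟩ := h₂
  set η := min ε δ with hη
  have hη0 : 0 < η := lt_min hε hδ
  have key : ∀ s : ℝ, 0 < s → s < 1 →
      x + ((2 * s - 1) * η) • v ∈ openSegment ℝ (x - η • v) (x + η • v) := by
    intro s hs hs'
    exact ⟨1 - s, s, by linarith, hs, by ring, by module⟩
  have hsub : openSegment ℝ (x - η • v) (x + η • v) ⊆ C := by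
    rintro _ ⟨a, b, ha, hb, hab, rfl⟩
    obtain rfl : a = 1 - b := by linarith
    rcases le_total 0 (2 * b - 1) with hb' | hb'
    · convert h ((2 * b - 1) * η) (by positivity)
        ((by nlinarith : _ ≤ η).trans (min_le_left _ _)) using 1
      module
    · convert k ((1 - 2 * b) * η) (mul_nonneg (by linarith) hη0.le)
        ((by nlinarith : _ ≤ η).trans (min_le_right _ _)) using 1
      module
  -- The endpoints are excluded, so the point taken has parameter `3/4`; `x` has parameter `1/2`.
  refine ⟨(2 * (3 / 4) - 1) * η, by positivity, ?_⟩
  refine hF.2.2 _ _ hsub ⟨x, ?_, hx⟩ (key (3 / 4) (by norm_num) (by norm_num))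
  simpa using key (1 / 2) (by norm_num) (by norm_num)

theorem IsFace.faceDirection_mem_vectorSpan {C F : Set E} (hF : IsFace C F) {x v : E} (hx : x ∈ F)
    (h₁ : Feasible C x v) (h₂ : Feasible C x (-v)) : v ∈ vectorSpan ℝ F := by
  obtain ⟨ε, hε, h⟩ := hF.mem_vectorSpan hx h₁ h₂
  have h3 := vsub_mem_vectorSpan ℝ h hx
  rw [vsub_eq_sub, add_sub_cancel_left] at h3
  simpa [smul_smul, inv_mul_cancel₀ hε.ne'] using Submodule.smul_mem _ ε⁻¹ h3

/-- The part of `C` in the affine subspace through `x` directed by `faceDirections`. -/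
def directionFace {C : Set E} (hC : Convex ℝ C) {x : E} (hx : x ∈ C) : Set E :=
  {y | y ∈ C ∧ y - x ∈ faceDirections hC hx}

theorem mem_directionFace {C : Set E} (hC : Convex ℝ C) {x : E} (hx : x ∈ C) :
    x ∈ directionFace hC hx := ⟨hx, by simp⟩

/-- A direction that `C` admits at `y` is admitted at `x` if `C` extends beyond `x` away
from `y`. -/
theorem Feasible.transfer {C : Set E} (hC : Convex ℝ C) {x y v : E}
    (hxy : Feasible C x (-(y - x))) (hv : Feasible C y v) : Feasible C x v := by
  obtain ⟨ε, hε, h⟩ := hxy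
  obtain ⟨δ, hδ, k⟩ := hv
  -- `x` divides the segment from `x - ε • (y - x)` to `y` with weights `1/(1+ε)` and `ε/(1+ε)`;
  -- displacements at `y` shrink by the factor `ε/(1+ε)`.
  refine ⟨δ * (ε / (1 + ε)), by positivity, fun s hs hs' => ?_⟩
  have h1 := h ε hε.le le_rfl
  have h2 := k (s * ((1 + ε) / ε)) (by positivity) (by
    calc s * ((1 + ε) / ε) ≤ δ * (ε / (1 + ε)) * ((1 + ε) / ε) := by gcongr
      _ = δ := by field_simp)
  have h3 := hC h1 h2 (a := 1 / (1 + ε)) (b := ε / (1 + ε)) (by positivity) (by positivity)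
    (by field_simp)
  convert h3 using 1
  match_scalars <;> field_simp
  ring

/-- The direction of an open segment in `C` is two-sided at any of its points, and
`Feasible.transfer` carries it from a point of the set to `x`. -/
theorem isFace_directionFace {C : Set E} (hC : Convex ℝ C) {x : E} (hx : x ∈ C) :
    IsFace C (directionFace hC hx) := by
  refine ⟨fun y hy => hy.1, ?_, ?_⟩
  · rintro y ⟨hy, hy'⟩ z ⟨hz, hz'⟩ a b ha hb hab
    refine ⟨hC hy hz ha hb hab, ?_⟩
    have := Submodule.add_mem _ (Submodule.smul_mem _ a hy') (Submodule.smul_mem _ b hz')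
    convert this using 1
    obtain rfl : a = 1 - b := by linarith
    module
  · rintro y z hyz ⟨_, ⟨a, b, ha, hb, hab, rfl⟩, hw, hw'⟩
    have feas : ∀ c : ℝ, Feasible C (a • y + b • z) (c • (z - y)) := by
      intro c
      refine ⟨min a b / (2 * (|c| + 1)), by positivity, fun s hs hs' => hyz ?_⟩
      have hc : |s * c| < min a b := by
        rw [abs_mul, abs_of_nonneg hs]
        rw [le_div_iff₀ (by positivity)] at hs'
        have : 0 < min a b := lt_min ha hb
        nlinarith [abs_nonneg c, mul_nonneg hs (abs_nonneg c)]
      rw [abs_lt] at hc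
      refine ⟨a - s * c, b + s * c, by linarith [min_le_left a b], by linarith [min_le_right a b],
        by linarith, by module⟩
    have hd : z - y ∈ faceDirections hC hx := by
      refine ⟨Feasible.transfer hC hw'.2 ?_, Feasible.transfer hC hw'.2 ?_⟩
      · simpa using feas 1
      · simpa using feas (-1)
    rintro _ ⟨a', b', ha', hb', hab', rfl⟩
    refine ⟨hyz ⟨a', b', ha', hb', hab', rfl⟩, ?_⟩
    convert Submodule.add_mem _ hw' (Submodule.smul_mem _ (b' - b) hd) using 1
    obtain rfl : a = 1 - b := by linarith
    obtain rfl : a' = 1 - b' := by linarith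
    module

theorem vectorSpan_directionFace {C : Set E} (hC : Convex ℝ C) {x : E} (hx : x ∈ C) :
    vectorSpan ℝ (directionFace hC hx) = faceDirections hC hx := by
  apply le_antisymm
  · rw [vectorSpan_eq_span_vsub_set_right ℝ (mem_directionFace hC hx), Submodule.span_le]
    rintro _ ⟨y, hy, rfl⟩
    exact hy.2
  · exact fun v hv => (isFace_directionFace hC hx).faceDirection_mem_vectorSpan
      (mem_directionFace hC hx) hv.1 hv.2

/-- The minimal face lies in `directionFace`; as an intersection of faces it is itself a face, so it
extends in all two-sided directions. -/
theorem vectorSpan_minFace {C : Set E} (hC : Convex ℝ C) {x : E} (hx : x ∈ C) :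
    vectorSpan ℝ (minFace C x) = faceDirections hC hx := by
  apply le_antisymm
  · rw [← vectorSpan_directionFace hC hx]
    exact vectorSpan_mono ℝ
      (Set.sInter_subset_of_mem ⟨isFace_directionFace hC hx, mem_directionFace hC hx⟩)
  · rintro v ⟨h₁, h₂⟩
    have hxm : x ∈ minFace C x := fun F hF => hF.2
    have hface : IsFace C (minFace C x) := by
      refine ⟨fun y hy => (hy _ ⟨isFace_directionFace hC hx, mem_directionFace hC hx⟩).1, convex_sInter fun F hF => hF.1.2.1, ?_⟩
      rintro y z hyz ⟨w, hw, hw'⟩ u hu F hF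
      exact hF.1.2.2 y z hyz ⟨w, hw, hw' F hF⟩ hu
    exact hface.faceDirection_mem_vectorSpan hxm h₁ h₂

theorem inFaceOfDimLE_of_finrank {C : Set E} (hC : Convex ℝ C) {x : E} (hx : x ∈ C)
    [FiniteDimensional ℝ (faceDirections hC hx)] {k : ℤ}
    (hk : (Module.finrank ℝ (faceDirections hC hx) : ℤ) ≤ k) : InFaceOfDimLE C x k := by
  refine ⟨directionFace hC hx, isFace_directionFace hC hx, mem_directionFace hC hx, _, ?_, hk⟩
  rw [affDim, direction_affineSpan, vectorSpan_directionFace, Module.finrank_eq_rank]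

theorem lt_of_affCodim_eq_one {S T : AffineSubspace ℝ E} (hST : S.direction ≤ T.direction)
    (h : affCodim S T = 1) : S.direction < T.direction := by
  refine lt_of_le_of_ne hST fun he => ?_
  rw [affCodim, he, Submodule.submoduleOf_self] at h
  simp at h

theorem direction_affineSpan_prod_singleton (F : Set E) (c : ℝ) :
    (affineSpan ℝ (F ×ˢ ({c} : Set ℝ))).direction =
      (vectorSpan ℝ F).map (LinearMap.inl ℝ E ℝ) := by
  rw [direction_affineSpan, Set.prod_singleton]
  have := AffineMap.map_vectorSpan
    ((LinearMap.inl ℝ E ℝ).toAffineMap + AffineMap.const ℝ E ((0 : E), c)) (s := F)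
  simpa [Set.image] using this.symm

end Directions

/-! ### Dimension count -/

section LinearAlgebra

variable {E M K : Type*} [AddCommGroup E] [Module ℝ E] [AddCommGroup M] [Module ℝ M]
  [FiniteDimensional ℝ M] [AddCommGroup K] [Module ℝ K] [FiniteDimensional ℝ K]

/-- Rank-nullity for `W → M ⧸ B`: the kernel `W ⊓ T⁻¹B` embeds in `K`, and the range lies in `(T W +
B) ⧸ B`. -/
theorem finrank_add_finrank_le (W : Submodule ℝ E) (B : Submodule ℝ M) (T : E →ₗ[ℝ] M)
    (i : (W ⊓ B.comap T : Submodule ℝ E) →ₗ[ℝ] K) (hi : Function.Injective i) :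
    FiniteDimensional ℝ W ∧ Module.finrank ℝ W + Module.finrank ℝ B ≤
      Module.finrank ℝ K + Module.finrank ℝ (W.map T ⊔ B : Submodule ℝ M) := by
  set g : W →ₗ[ℝ] M ⧸ B := B.mkQ ∘ₗ T ∘ₗ W.subtype with hg
  have hker : ∀ w : LinearMap.ker g, ((w : W) : E) ∈ W ⊓ B.comap T := by
    rintro ⟨⟨w, hw⟩, h⟩
    refine ⟨hw, ?_⟩
    simpa [hg] using h
  let e : LinearMap.ker g →ₗ[ℝ] (W ⊓ B.comap T : Submodule ℝ E) :=
    (W.subtype ∘ₗ (LinearMap.ker g).subtype).codRestrict _ hker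
  have he : Function.Injective (i ∘ₗ e) := by
    refine hi.comp fun a b hab => ?_
    have h : (e a : E) = e b := by rw [hab]
    exact Subtype.ext (Subtype.ext h)
  have : FiniteDimensional ℝ (LinearMap.ker g) := Module.Finite.of_injective _ he
  have hWfin : FiniteDimensional ℝ W := by
    have : FiniteDimensional ℝ (W ⧸ LinearMap.ker g) :=
      Module.Finite.equiv g.quotKerEquivRange.symm
    exact Module.Finite.of_submodule_quotient (LinearMap.ker g)
  refine ⟨hWfin, ?_⟩
  have h1 := LinearMap.finrank_le_finrank_of_injective he
  have h2 := LinearMap.finrank_range_add_finrank_ker g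
  set N := W.map T ⊔ B
  have h3 := LinearMap.finrank_range_add_finrank_ker (B.mkQ ∘ₗ N.subtype)
  have h4 : Module.finrank ℝ (LinearMap.range g) ≤
      Module.finrank ℝ (LinearMap.range (B.mkQ ∘ₗ N.subtype)) := by
    refine Submodule.finrank_mono ?_
    rintro _ ⟨w, rfl⟩
    exact ⟨⟨T w, Submodule.mem_sup_left ⟨w, w.2, rfl⟩⟩, rfl⟩
  have h5 : Module.finrank ℝ B ≤ Module.finrank ℝ (LinearMap.ker (B.mkQ ∘ₗ N.subtype)) := by
    have hB : ∀ b : B, (Submodule.inclusion (le_sup_right : B ≤ N)) b ∈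
        LinearMap.ker (B.mkQ ∘ₗ N.subtype) := by
      intro b
      simp
    refine LinearMap.finrank_le_finrank_of_injective
      (f := (Submodule.inclusion (le_sup_right : B ≤ N)).codRestrict _ hB) ?_
    intro a b hab
    exact Submodule.inclusion_injective _ (congrArg Subtype.val hab)
  omega

end LinearAlgebra

/-! ### Epigraphs, hypographs and first order optimality -/

section Optimality

variable {V : Type*} [AddCommGroup V] [Module ℝ V] {m : ℕ}

theorem IsConvexFun.convex_levelSet {E : Type*} [AddCommGroup E] [Module ℝ E] {g : E → EReal}
    (hg : IsConvexFun g) (c : ℝ) : Convex ℝ (levelSet g c) := by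
  intro x hx y hy a b ha hb hab
  have := hg.2 (show (x, c) ∈ epigraph g from hx) (show (y, c) ∈ epigraph g from hy) ha hb hab
  simpa [epigraph, levelSet, ← add_mul, hab] using this

theorem feasible_levelSet_iff {E : Type*} [AddCommGroup E] [Module ℝ E] {g : E → EReal} {c : ℝ}
    {x v : E} : Feasible (levelSet g c) x v ↔ Feasible (epigraph g) (x, c) (v, 0) := by
  simp [Feasible, levelSet, epigraph]

/-- The reflection `(w, r) ↦ (w, t - r)` transfers convexity and feasible directions from the
epigraph of `f`. -/
theorem mem_hypograph_iff {E : Type*} {f : E → EReal} (t : ℝ) (q : E × ℝ) :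
    q ∈ hypograph (fun z => (t : EReal) - f z) ↔ (q.1, t - q.2) ∈ epigraph f := by
  rcases q with ⟨w, r⟩
  change (r : EReal) ≤ (t : EReal) - f w ↔ f w ≤ ((t - r : ℝ) : EReal)
  induction f w with
  | bot => simp
  | top => simpa using EReal.coe_ne_top (t - r)
  | coe y =>
    norm_cast
    constructor <;> intro h <;> linarith

theorem IsConvexFun.convex_hypograph {E : Type*} [AddCommGroup E] [Module ℝ E] {f : E → EReal}
    (hf : IsConvexFun f) (t : ℝ) : Convex ℝ (hypograph fun z => (t : EReal) - f z) := by
  intro x hx y hy a b ha hb hab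
  rw [mem_hypograph_iff] at hx hy ⊢
  convert hf.2 hx hy ha hb hab using 1
  ext
  · simp
  · simp
    linear_combination (-t) * hab

theorem feasible_hypograph_iff {E : Type*} [AddCommGroup E] [Module ℝ E] {f : E → EReal}
    {t r s : ℝ} {x v : E} : Feasible (hypograph fun z => (t : EReal) - f z) (x, r) (v, s) ↔
      Feasible (epigraph f) (x, t - r) (v, -s) := by
  simp only [Feasible, mem_hypograph_iff]
  simp [sub_eq_add_neg, add_assoc, add_comm]

/-- First order optimality in terms of the feasible directions of the two epigraphs. -/
theorem nonneg_of_feasible {R : V → EReal} {f : (Fin m → ℝ) → EReal} {Φ : V →ₗ[ℝ] (Fin m → ℝ)}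
    {p : V} (hp : p ∈ solutionSet R f Φ) {a b : ℝ} (ha : R p = a) (hb : f (Φ p) = b)
    {u : V} {r s : ℝ} (hu : Feasible (epigraph R) (p, a) (u, r))
    (hw : Feasible (epigraph f) (Φ p, b) (Φ u, s)) : 0 ≤ r + s := by
  obtain ⟨ε, hε, h⟩ := hu
  obtain ⟨δ, hδ, k⟩ := hw
  have hη : 0 < min ε δ := lt_min hε hδ
  have h1 : R (p + min ε δ • u) ≤ ((a + min ε δ * r : ℝ) : EReal) := h _ hη.le (min_le_left _ _)
  have h2 : f (Φ p + min ε δ • Φ u) ≤ ((b + min ε δ * s : ℝ) : EReal) :=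
    k _ hη.le (min_le_right _ _)
  have h3 := hp (p + min ε δ • u)
  rw [ha, hb, map_add, map_smul] at h3
  have h4 := h3.trans (add_le_add h1 h2)
  norm_cast at h4
  by_contra! hneg
  nlinarith

theorem mem_solutionSet {R : V → EReal} {f : (Fin m → ℝ) → EReal} {Φ : V →ₗ[ℝ] (Fin m → ℝ)}
    {p : V} (hp : p ∈ solutionSet R f Φ) {a b : ℝ} (ha : R p = a) (hb : f (Φ p) = b)
    {u : V} {r s : ℝ} (hu : (u, r) ∈ epigraph R) (hw : (Φ u, s) ∈ epigraph f)
    (hrs : r + s = a + b) : u ∈ solutionSet R f Φ := by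
  intro v
  refine le_trans ?_ (hp v)
  rw [ha, hb]
  refine (add_le_add hu hw).trans ?_
  norm_cast
  exact hrs.le

/-- The slopes `r` and `-r` cancel, so the objective stays at most `a + b`. -/
theorem feasible_solutionSet {R : V → EReal} {f : (Fin m → ℝ) → EReal} {Φ : V →ₗ[ℝ] (Fin m → ℝ)}
    {p : V} (hp : p ∈ solutionSet R f Φ) {a b : ℝ} (ha : R p = a) (hb : f (Φ p) = b)
    {u : V} {r : ℝ} (hu : Feasible (epigraph R) (p, a) (u, r))
    (hw : Feasible (epigraph f) (Φ p, b) (Φ u, -r)) : Feasible (solutionSet R f Φ) p u := by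
  obtain ⟨ε, hε, h⟩ := hu
  obtain ⟨δ, hδ, k⟩ := hw
  refine ⟨min ε δ, lt_min hε hδ, fun s hs hs' => ?_⟩
  have h1 := h s hs (hs'.trans (min_le_left _ _))
  have h2 := k s hs (hs'.trans (min_le_right _ _))
  refine mem_solutionSet hp ha hb (r := a + s * r) (s := b + s * -r) h1 ?_ (by ring)
  rw [map_add, map_smul]
  exact h2

end Optimality

/-! ### Dimension bounds at a minimizer -/

section Bounds

variable {V : Type*} [AddCommGroup V] [Module ℝ V] {m : ℕ}
  {R : V → EReal} {f : (Fin m → ℝ) → EReal} {Φ : V →ₗ[ℝ] (Fin m → ℝ)} {p : V}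

theorem IsConvexFun.exists_eq_coe {E : Type*} [AddCommGroup E] [Module ℝ E] {g : E → EReal}
    (hg : IsConvexFun g) {x : E} (hx : g x ≠ ⊤) : ∃ c : ℝ, g x = c :=
  ⟨(g x).toReal, (EReal.coe_toReal hx (hg.1 x)).symm⟩

theorem exists_feasible_neg {E : Type*} [AddCommGroup E] [Module ℝ E] {g : E → EReal}
    (hg : IsConvexFun g) {x : E} {c : ℝ} (hx : g x = c) (hlt : (⨅ u, g u) < g x) :
    ∃ v : E, ∃ r < (0 : ℝ), Feasible (epigraph g) (x, c) (v, r) := by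
  obtain ⟨u, hu⟩ := iInf_lt_iff.1 hlt
  obtain ⟨r, hr, hr'⟩ := EReal.lt_iff_exists_real_btwn.1 hu
  rw [hx] at hr'
  have hr'' : r < c := by exact_mod_cast hr'
  have h := feasible_sub hg.2 (x := (x, c)) (y := (u, r)) hx.le hr.le
  exact ⟨u - x, r - c, by linarith, h⟩

/-- Unless both terms are minimal, the directions of the two level sets do not span. -/
theorem map_sup_ne_top (hR : IsConvexFun R) (hf : IsConvexFun f)
    (hp : p ∈ solutionSet R f Φ) {a b : ℝ} (ha : R p = a) (hb : f (Φ p) = b)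
    (hlt : (⨅ u, R u) < R p ∨ (⨅ w, f w) < f (Φ p)) :
    (faceDirections (hR.convex_levelSet a) (x := p) ha.le).map Φ ⊔
      faceDirections (hf.convex_levelSet b) (x := Φ p) hb.le ≠ ⊤ := by
  intro htop
  rcases hlt with h | h
  -- With `Φ v = Φ u + w`, the direction `v - u` still has slope `r < 0` for `R`, while its image
  -- `w` has slope `0` for `f`.
  · obtain ⟨v, r, hr, hv⟩ := exists_feasible_neg hR ha h
    obtain ⟨_, ⟨u, hu, rfl⟩, w, hw, huw⟩ :=
      Submodule.mem_sup.1 (htop ▸ Submodule.mem_top : Φ v ∈ _)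
    have h1 := hv.add hR.2 (feasible_levelSet_iff.1 hu.2)
    have h2 := feasible_levelSet_iff.1 hw.1
    obtain rfl : w = Φ (v + -u) := by
      rw [map_add, map_neg, ← huw]
      abel
    have := nonneg_of_feasible hp ha hb (u := v + -u) (r := r + 0) (s := 0) h1 h2
    linarith
  · obtain ⟨v, r, hr, hv⟩ := exists_feasible_neg hf hb h
    obtain ⟨_, ⟨u, hu, rfl⟩, w, hw, huw⟩ :=
      Submodule.mem_sup.1 (htop ▸ Submodule.mem_top : v ∈ _)
    have h1 := hv.add hf.2 (feasible_levelSet_iff.1 hw.2)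
    have h2 := feasible_levelSet_iff.1 hu.1
    have h3 : v + -w = Φ u := by
      rw [← huw]
      abel
    rw [Prod.mk_add_mk, h3] at h1
    have := nonneg_of_feasible hp ha hb h2 h1
    linarith

theorem finite_and_finrank_of_affDim_eq {E : Type*} [AddCommGroup E] [Module ℝ E] {F : Set E}
    {j : ℕ} (h : affDim F = j) :
    FiniteDimensional ℝ (vectorSpan ℝ F) ∧ Module.finrank ℝ (vectorSpan ℝ F) = j := by
  rw [affDim, direction_affineSpan] at h
  refine ⟨Module.rank_lt_aleph0_iff.1 ?_, Module.finrank_eq_of_rank_eq h⟩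
  rw [h]
  exact Cardinal.natCast_lt_aleph0

theorem finrank_levelSet_le (hR : IsConvexFun R) (hf : IsConvexFun f)
    (hp : p ∈ solutionSet R f Φ) {a b : ℝ} (ha : R p = a) (hb : f (Φ p) = b) {F : Set V}
    (hF : IsFace (solutionSet R f Φ) F) (hpF : p ∈ F) [FiniteDimensional ℝ (vectorSpan ℝ F)] :
    FiniteDimensional ℝ (faceDirections (hR.convex_levelSet a) (x := p) ha.le) ∧
    Module.finrank ℝ (faceDirections (hR.convex_levelSet a) (x := p) ha.le) +
      Module.finrank ℝ (faceDirections (hf.convex_levelSet b) (x := Φ p) hb.le) ≤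
    Module.finrank ℝ (vectorSpan ℝ F) + Module.finrank ℝ
      ((faceDirections (hR.convex_levelSet a) (x := p) ha.le).map Φ ⊔
        faceDirections (hf.convex_levelSet b) (x := Φ p) hb.le : Submodule ℝ (Fin m → ℝ)) := by
  refine finrank_add_finrank_le _ _ Φ (Submodule.inclusion ?_) (Submodule.inclusion_injective _)
  rintro u ⟨⟨h1, h2⟩, h3, h4⟩
  refine hF.faceDirection_mem_vectorSpan hpF ?_ ?_
  · exact feasible_solutionSet hp ha hb (r := 0) (feasible_levelSet_iff.1 h1)
      (by simpa using feasible_levelSet_iff.1 h3)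
  · exact feasible_solutionSet hp ha hb (r := 0) (feasible_levelSet_iff.1 h2)
      (by simpa using feasible_levelSet_iff.1 h4)

theorem map_inl_faceDirections_le {E : Type*} [AddCommGroup E] [Module ℝ E] {g : E → EReal}
    (hg : IsConvexFun g) {x : E} {c r : ℝ} (hx : g x = c) {C : Set (E × ℝ)} (hC : Convex ℝ C)
    (hxC : (x, r) ∈ C)
    (h : ∀ v, Feasible (epigraph g) (x, c) (v, 0) → Feasible C (x, r) (v, 0)) :
    (faceDirections (hg.convex_levelSet c) (x := x) hx.le).map (LinearMap.inl ℝ E ℝ) ≤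
      faceDirections hC hxC := by
  rintro _ ⟨v, ⟨h1, h2⟩, rfl⟩
  refine ⟨h _ (feasible_levelSet_iff.1 h1), ?_⟩
  simpa using h _ (feasible_levelSet_iff.1 h2)

/-- An oblique minimal face has more directions than the minimal face of the level set. -/
theorem finrank_lt_of_affCodim_eq_one {E : Type*} [AddCommGroup E] [Module ℝ E] {g : E → EReal}
    (hg : IsConvexFun g) {x : E} {c r : ℝ} (hx : g x = c) {C : Set (E × ℝ)} (hC : Convex ℝ C)
    (hxC : (x, r) ∈ C)
    (h : ∀ v, Feasible (epigraph g) (x, c) (v, 0) → Feasible C (x, r) (v, 0))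
    (hcodim : affCodim (affineSpan ℝ (minFace (levelSet g c) x ×ˢ ({r} : Set ℝ)))
      (affineSpan ℝ (minFace C (x, r))) = 1)
    [FiniteDimensional ℝ (faceDirections hC hxC)] :
    Module.finrank ℝ (faceDirections (hg.convex_levelSet c) (x := x) hx.le) <
      Module.finrank ℝ (faceDirections hC hxC) := by
  have h1 : (affineSpan ℝ (minFace (levelSet g c) x ×ˢ ({r} : Set ℝ))).direction =
      (faceDirections (hg.convex_levelSet c) (x := x) hx.le).map (LinearMap.inl ℝ E ℝ) := by
    rw [direction_affineSpan_prod_singleton, vectorSpan_minFace (hg.convex_levelSet c) hx.le]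
  have h2 : (affineSpan ℝ (minFace C (x, r))).direction = faceDirections hC hxC := by
    rw [direction_affineSpan, vectorSpan_minFace]
  have hlt := lt_of_affCodim_eq_one
    (by rw [h1, h2]; exact map_inl_faceDirections_le hg hx hC hxC h) hcodim
  rw [h1, h2] at hlt
  have h3 := Submodule.finrank_lt_finrank_of_lt hlt
  rwa [← (Submodule.equivMapOfInjective _ LinearMap.inl_injective _).finrank_eq] at h3

theorem finrank_epigraph_add_le (hR : IsConvexFun R) (hf : IsConvexFun f)
    (hp : p ∈ solutionSet R f Φ) {a b : ℝ} (ha : R p = a) (hb : f (Φ p) = b) {F : Set V}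
    (hF : IsFace (solutionSet R f Φ) F) (hpF : p ∈ F) [FiniteDimensional ℝ (vectorSpan ℝ F)]
    (hH : (Φ p, a) ∈ hypograph fun z => ((a + b : ℝ) : EReal) - f z) :
    FiniteDimensional ℝ (faceDirections hR.2 (x := (p, a)) ha.le) ∧
    Module.finrank ℝ (faceDirections hR.2 (x := (p, a)) ha.le) +
      Module.finrank ℝ (faceDirections (hf.convex_hypograph (a + b)) hH) ≤
    Module.finrank ℝ (vectorSpan ℝ F) + m := by
  have hfeas : ∀ {w : Fin m → ℝ} {s : ℝ},
      Feasible (hypograph fun z => ((a + b : ℝ) : EReal) - f z) (Φ p, a) (w, s) →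
        Feasible (epigraph f) (Φ p, b) (w, -s) := by
    intro w s h
    simpa using feasible_hypograph_iff.1 h
  set W := faceDirections hR.2 (x := (p, a)) ha.le with hW
  set B := faceDirections (hf.convex_hypograph (a + b)) hH with hB
  set T : V × ℝ →ₗ[ℝ] (Fin m → ℝ) × ℝ := Φ.prodMap LinearMap.id with hT
  have hmem : ∀ q : (W ⊓ B.comap T : Submodule ℝ (V × ℝ)),
      ((LinearMap.fst ℝ V ℝ) ∘ₗ (W ⊓ B.comap T).subtype) q ∈ vectorSpan ℝ F := by
    rintro ⟨⟨u, r⟩, ⟨h1, h2⟩, h3, h4⟩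
    refine hF.faceDirection_mem_vectorSpan hpF ?_ ?_
    · exact feasible_solutionSet hp ha hb h1 (hfeas h3)
    · refine feasible_solutionSet hp ha hb (r := -r) h2 ?_
      rw [map_neg]
      exact hfeas h4
  have hinj : Function.Injective (((LinearMap.fst ℝ V ℝ) ∘ₗ
      (W ⊓ B.comap T).subtype).codRestrict _ hmem) := by
    -- A two-sided vertical direction `(0, r)` must vanish: optimality against the zero direction of
    -- `f` gives `0 ≤ r` and `0 ≤ -r`.
    rw [injective_iff_map_eq_zero]
    rintro ⟨⟨u, r⟩, ⟨h1, h2⟩, _⟩ h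
    obtain rfl : u = 0 := congrArg Subtype.val h
    have h0 : Feasible (epigraph f) (Φ p, b) (Φ 0, 0) := by
      rw [map_zero]
      exact feasible_zero hb.le
    have h5 := nonneg_of_feasible hp ha hb h1 h0
    rw [Prod.neg_mk, neg_zero] at h2
    have h6 := nonneg_of_feasible hp ha hb h2 h0
    obtain rfl : r = 0 := by linarith
    rfl
  obtain ⟨hfin, hle⟩ := finrank_add_finrank_le W B T _ hinj
  refine ⟨hfin, ?_⟩
  -- A decomposition of `(0, -1)` would give slopes of `R` and `f` along `u` with sum `-1`, against
  -- optimality.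
  have hne : W.map T ⊔ B ≠ ⊤ := by
    intro htop
    obtain ⟨_, ⟨⟨u, r⟩, hu, rfl⟩, ⟨w, s⟩, hw, huw⟩ :=
      Submodule.mem_sup.1 (htop ▸ Submodule.mem_top : ((0, -1) : (Fin m → ℝ) × ℝ) ∈ _)
    have h1 : Φ u + w = 0 := congrArg Prod.fst huw
    have h2 : r + s = -1 := congrArg Prod.snd huw
    have h3 := hfeas hw.2
    rw [← eq_neg_of_add_eq_zero_left h1, neg_neg] at h3
    have := nonneg_of_feasible hp ha hb hu.1 h3
    linarith
  have hlt := Submodule.finrank_lt hne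
  rw [Module.finrank_prod, Module.finrank_fin_fun, Module.finrank_self] at hlt
  omega

end Bounds

end FacePrinciple

/-! ### The three bounds -/

open FacePrinciple
theorem theorem1 {V : Type*} [AddCommGroup V] [Module ℝ V] {m : ℕ}
    (R : V → EReal) (f : (Fin m → ℝ) → EReal) (Φ : V →ₗ[ℝ] (Fin m → ℝ))
    (hR : IsConvexFun R) (hf : IsConvexFun f) (hΦ : Function.Surjective Φ)
    (p : V) (hp : p ∈ solutionSet R f Φ) (hfin : R p + f (Φ p) < ⊤)
    (hclosed : LinearlyClosed (levelSet R (R p)))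
    (hline : ¬ ContainsLine (levelSet R (R p)))
    (j : ℕ) (F : Set V) (hF : IsFace (solutionSet R f Φ) F) (hpF : p ∈ F) (hj : affDim F = j)
    (ℓ : ℕ) (hℓ : affDim (minFace (levelSet f (f (Φ p))) (Φ p)) = ℓ) :
    (((⨅ u, R u) < R p ∨ (⨅ w, f w) < f (Φ p)) →
      InFaceOfDimLE (levelSet R (R p)) p ((m : ℤ) - ℓ + j - 1)) ∧
    (¬ ((⨅ u, R u) < R p ∨ (⨅ w, f w) < f (Φ p)) →
      InFaceOfDimLE (levelSet R (R p)) p ((m : ℤ) - ℓ + j)) ∧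
    (DoublyOblique R f Φ p →
      InFaceOfDimLE (levelSet R (R p)) p ((m : ℤ) - ℓ + j - 2)) := by
  have hRtop : R p ≠ ⊤ := by
    intro h
    rw [h, EReal.top_add_of_ne_bot (hf.1 _)] at hfin
    exact lt_irrefl _ hfin
  have hftop : f (Φ p) ≠ ⊤ := by
    intro h
    rw [h, EReal.add_top_of_ne_bot (hR.1 _)] at hfin
    exact lt_irrefl _ hfin
  obtain ⟨a, ha⟩ := hR.exists_eq_coe hRtop
  obtain ⟨b, hb⟩ := hf.exists_eq_coe hftop
  obtain ⟨hFfin, hFrank⟩ := finite_and_finrank_of_affDim_eq hj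
  rw [hb] at hℓ
  have hℓrank := (finite_and_finrank_of_affDim_eq hℓ).2
  rw [vectorSpan_minFace (hf.convex_levelSet b) hb.le] at hℓrank
  obtain ⟨hAfin, hA⟩ := finrank_levelSet_le hR hf hp ha hb hF hpF
  rw [hFrank, hℓrank] at hA
  refine ⟨fun h => ?_, fun _ => ?_, fun h => ?_⟩
  · have hlt := Submodule.finrank_lt (map_sup_ne_top hR hf hp ha hb h)
    rw [Module.finrank_fin_fun] at hlt
    rw [ha]
    exact inFaceOfDimLE_of_finrank (hR.convex_levelSet a) ha.le (by omega)
  · have hle := Submodule.finrank_le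
      ((faceDirections (hR.convex_levelSet a) (x := p) ha.le).map Φ ⊔
        faceDirections (hf.convex_levelSet b) (x := Φ p) hb.le)
    rw [Module.finrank_fin_fun] at hle
    rw [ha]
    exact inFaceOfDimLE_of_finrank (hR.convex_levelSet a) ha.le (by omega)
  · have hH : (Φ p, a) ∈ hypograph fun z => ((a + b : ℝ) : EReal) - f z := by
      rw [mem_hypograph_iff]
      simpa [epigraph] using hb.le
    obtain ⟨hRobl, hfobl⟩ := h
    have hsum : R p + f (Φ p) = ((a + b : ℝ) : EReal) := by
      rw [ha, hb, EReal.coe_add]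
    have hdiff : (((a + b : ℝ) : EReal) - (b : EReal)).toReal = a := by
      rw [← EReal.coe_sub, EReal.toReal_coe, add_sub_cancel_right]
    rw [EpiOblique, ha, EReal.toReal_coe] at hRobl
    rw [hsum, HypoOblique, hb, hdiff] at hfobl
    obtain ⟨hGfin, hG⟩ := finrank_epigraph_add_le hR hf hp ha hb hF hpF hH
    -- Each strict inequality lowers the bound `m + j` of `hG` by one.
    have h1 := finrank_lt_of_affCodim_eq_one hR ha hR.2 ha.le (fun _ hv => hv) hRobl
    have h2 := finrank_lt_of_affCodim_eq_one hf hb (hf.convex_hypograph (a + b)) hH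
      (fun v hv => feasible_hypograph_iff.2 (by simpa using hv)) hfobl
    rw [ha]
    exact inFaceOfDimLE_of_finrank (hR.convex_levelSet a) ha.le (by omega)
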